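/- Let $k$ be a field of characteristic $0$ and let $f(x)=a_nx^n+a_{n-1}x^{n-1}+\dots+a_0\in k[x]$ be a polynomial of degree $n>0$; put $a_m=0$ for $m<0$. The Sturm sequence of $f$ is defined by $f_0=f$, $f_1=f'$ and, for $j\ge 1$ and as long as $f_j\neq 0$, $f_{j+1}$ is the negative of the remainder of the Euclidean division of $f_{j-1}$ by $f_j$ (so $f_{j-1}=q_{j-1}f_j-f_{j+1}$ with $\deg f_{j+1}<\deg f_j$); the sequence stops at its last non-zero term. For $j\ge 1$ and $i\ge 2j$ put $$b(j)_i=n\sum_{p=0}^{j-1}(i-2p)\,a_{n-p}\,a_{n-i+p}-j(n-i+j)\,a_{n-j}\,a_{n+j-i}.$$ For $m\ge 2$ let $C(m)$ be the symmetric $(m-1)\times(m-1)$ matrix whose entry in row $r$ and column $s$ is $b(\min(r,s))_{r+s}$ ($1\le r,s\le m-1$). For $i\ge 0$ let $C(m)_i$ be the matrix obtained from $C(m)$ by replacing its last row by $$\bigl(b(1)_{m+i},\ b(2)_{m+i+1},\ \dots,\ b(m-1)_{2m+i-2}\bigr).$$ Put $c(m)_i=\det C(m)_i$ for $m\ge 2$,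 $c(1)_i=\dfrac{(n-i)a_{n-i}}{n a_n}$, and $c(m)=c(m)_0$ for $m\ge 1$. Finally put $$\gamma_1=na_n,\qquad \gamma_2=-\frac1{n^2a_n},\qquad \gamma_{j+1}=\gamma_{j-1}\cdot\frac{c(j-1)^2}{c(j)^2}\quad(j\ge 2);$$ $\gamma_i$ is well defined as soon as $c(2),\dots,c(i-1)$ are non-zero. **Theorem.** Let $0\le j\le n$ and suppose that $f_j$ is a non-zero term of the Sturm sequence, with $\deg f_j=n-j$. Then $\deg f_i=n-i$ for all $0\le i\le j$, and for all $1\le i\le j$ one has $c(i)\neq 0$ and $$f_i(x)=\gamma_i\sum_{p=0}^{n-i}c(i)_p\,x^{n-i-p}.$$ In particular, the leading coefficient of $f_i$ is $\gamma_i\,c(i)$. -/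

import Mathlib

open Polynomial

noncomputable section

namespace SturmQuadrics

variable {k : Type*} [Field k]

open Classical in
/-- The Sturm sequence `f₀ = f`, `f₁ = f'`, and `f_{j+2} = -(f_j mod f_{j+1})` as long as
`f_{j+1} ≠ 0`. The sequence ends with its last non-zero term; it is continued by `0`. -/
def sturm (f : k[X]) : ℕ → k[X]
  | 0 => f
  | 1 => derivative f
  | j + 2 => if sturm f (j + 1) = 0 then 0 else -(sturm f j % sturm f (j + 1))

/-- The coefficient `a_m` of `x ^ m` in `f` for `m ∈ ℤ`, with `a_m = 0` for `m < 0`. -/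
def coeffZ (f : k[X]) (m : ℤ) : k :=
  if m < 0 then 0 else f.coeff m.toNat

/-- `b(j)_i = n ∑_{p=0}^{j-1} (i - 2p) a_{n-p} a_{n-i+p} - j (n - i + j) a_{n-j} a_{n+j-i}`,
where `n = deg f`; used for `j ≥ 1`, `i ≥ 2j`. -/
def b (f : k[X]) (j i : ℕ) : k :=
  (f.natDegree : k) *
      ∑ p ∈ Finset.range j, ((i : k) - 2 * (p : k)) *
        coeffZ f ((f.natDegree : ℤ) - p) * coeffZ f ((f.natDegree : ℤ) - i + p)
    - (j : k) * ((f.natDegree : k) - i + j) *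
        coeffZ f ((f.natDegree : ℤ) - j) * coeffZ f ((f.natDegree : ℤ) + j - i)

/-- The symmetric `(m-1) × (m-1)` matrix `C(m)`, `m ≥ 2`. In the usual numbering of rows and
columns from `1`, its entry at `(r, s)` is `b(min r s)_{r+s}`. -/
def matC (f : k[X]) (m : ℕ) : Matrix (Fin (m - 1)) (Fin (m - 1)) k :=
  Matrix.of fun r s => b f (min ((r : ℕ) + 1) ((s : ℕ) + 1)) (((r : ℕ) + 1) + ((s : ℕ) + 1))

/-- The shifted matrix `C(m)_i`, `m ≥ 2`: the last row of `C(m)` is replaced by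
`(b(1)_{m+i}, b(2)_{m+i+1}, …, b(m-1)_{2m+i-2})`. -/
def matCShift (f : k[X]) (m i : ℕ) : Matrix (Fin (m - 1)) (Fin (m - 1)) k :=
  Matrix.of fun r s =>
    if (r : ℕ) + 1 = m - 1 then b f ((s : ℕ) + 1) (m + i + (s : ℕ)) else matC f m r s

/-- `c(1)_i = (n - i) a_{n-i} / (n a_n)`, and `c(m)_i = det C(m)_i` for `m ≥ 2`
(the value at `m = 0` is not used). -/
def c (f : k[X]) (m i : ℕ) : k :=
  if m = 1 then
    ((f.natDegree : k) - i) * coeffZ f ((f.natDegree : ℤ) - i) /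
      ((f.natDegree : k) * coeffZ f (f.natDegree : ℤ))
  else (matCShift f m i).det

/-- `γ₁ = n a_n`, `γ₂ = -1 / (n² a_n)`, `γ_{j+1} = γ_{j-1} c(j-1)² / c(j)²` for `j ≥ 2`, where
`c(m) = c(m)_0` (the value at `0` is not used). -/
def gam (f : k[X]) : ℕ → k
  | 0 => 0
  | 1 => (f.natDegree : k) * coeffZ f (f.natDegree : ℤ)
  | 2 => -1 / ((f.natDegree : k) ^ 2 * coeffZ f (f.natDegree : ℤ))
  | j + 3 => gam f (j + 1) * (c f (j + 1) 0 ^ 2 / c f (j + 2) 0 ^ 2)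

end SturmQuadrics

end

/-!
The matrix with entries `b(min r s)_{r+s}` is a Bezout matrix, namely that of `g = f'` and
`h = n f - x f'`, both regarded as polynomials of formal degree `n - 1`. Writing
`g = ∑ G_p x^{n-1-p}` and `h = ∑ H_{p+1} x^{n-1-p}` with `G_p = (n-p) a_{n-p}` and
`H_p = p a_{n-p}`, this amounts to the recursion
`bez (r+1, s) - bez (r, s+1) = G_r H_{s+1} - G_s H_{r+1}` (`bez_succ_left`). Consequently the
`r`-th row lists the coefficients of a polynomial `B_r = A_r h - E_r g` of degree `< n - 1`, where
`deg A_r = r - 1` and `A_r` has leading coefficient `G_0 = n a_n` (`coeff_bezRow`).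

Every term `f_m` (`m ≥ 2`) of a Sturm sequence in which all degrees drop by one is of the form
`α h + β g` with `deg α = m - 2`. Eliminating `α` by means of the `A_r` leaves a multiple of `g` of
degree `< deg g`, that is, zero; so `f_m` is a combination of `B_1, …, B_{m-1}`
(`exists_eq_sum_bezRow`). In other words, a lower triangular matrix turns `C(m)_i` into an upper
triangular one with the leading coefficients of `f_2, …, f_{m-1}` and the coefficient of
`x^{n-m-i}` in `f_m` on its diagonal (`prod_mul_c`). Comparing determinants shows that
`c(m)_i` is proportional to that coefficient. The factor is `γ_m` because the leading coefficient
of `α` is multiplied by `lc f_{m-1} / lc f_m` when passing from `f_m` to `f_{m+1}`.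
-/

open Polynomial

namespace SturmQuadrics

variable {k : Type*} [Field k]

/-! ### The Bezout recursion for the entries of `C(m)` -/

/-- The coefficient `a_{n-p}` of `f`, where `n = deg f`; it is `0` for `p > n`. -/
noncomputable def topCoeff (f : k[X]) (p : ℕ) : k :=
  coeffZ f ((f.natDegree : ℤ) - p)

/-- The coefficient `G_p = (n - p) a_{n-p}` of `x ^ (n-1-p)` in `f'`. -/
noncomputable def gCoeff (f : k[X]) (p : ℕ) : k :=
  ((f.natDegree : k) - p) * topCoeff f p

/-- The coefficient `H_p = p a_{n-p}` of `x ^ (n-p)` in `n f - x f'`. -/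
noncomputable def hCoeff (f : k[X]) (p : ℕ) : k :=
  (p : k) * topCoeff f p

/-- The entry at `(r, s)` of the infinite matrix of which all the `C(m)` are corners. Rows and
columns are numbered from `1`; a row and a column of zeros with number `0` are added. -/
noncomputable def bez (f : k[X]) (r s : ℕ) : k :=
  b f (min r s) (r + s)

lemma topCoeff_eq_coeff (f : k[X]) {d p : ℕ} (h : d + p = f.natDegree) :
    topCoeff f p = f.coeff d := by
  have : (f.natDegree : ℤ) - p = d := by omega
  simp [topCoeff, coeffZ, this]

lemma topCoeff_of_lt (f : k[X]) {p : ℕ} (h : f.natDegree < p) : topCoeff f p = 0 := by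
  have : (f.natDegree : ℤ) - p < 0 := by omega
  rw [topCoeff, coeffZ, if_pos this]

lemma bez_comm (f : k[X]) (r s : ℕ) : bez f r s = bez f s r := by
  rw [bez, bez, min_comm, add_comm]

lemma bez_zero_left (f : k[X]) (s : ℕ) : bez f 0 s = 0 := by
  simp [bez, b]

lemma bez_of_le (f : k[X]) {r s : ℕ} (h : r ≤ s) :
    bez f r s = (f.natDegree : k) *
      ∑ p ∈ Finset.range r, ((r : k) + s - 2 * p) * topCoeff f p * topCoeff f (r + s - p)
      - r * topCoeff f r * gCoeff f s := by
  rw [bez, min_eq_left h, b]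
  have h1 : ∀ p ∈ Finset.range r,
      (((r + s : ℕ) : k) - 2 * (p : k)) * coeffZ f ((f.natDegree : ℤ) - p) *
        coeffZ f ((f.natDegree : ℤ) - (r + s : ℕ) + p) =
      ((r : k) + s - 2 * p) * topCoeff f p * topCoeff f (r + s - p) := by
    intro p hp
    rw [Finset.mem_range] at hp
    have : (f.natDegree : ℤ) - (r + s : ℕ) + p = f.natDegree - (r + s - p : ℕ) := by omega
    rw [this, topCoeff, topCoeff]
    push_cast
    ring
  have h2 : (f.natDegree : ℤ) + r - (r + s : ℕ) = f.natDegree - s := by push_cast; ring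
  rw [Finset.sum_congr rfl h1, h2, gCoeff, topCoeff, topCoeff]
  push_cast
  ring

lemma bez_succ_left_of_lt (f : k[X]) {r s : ℕ} (h : r < s) :
    bez f (r + 1) s =
      bez f r (s + 1) + gCoeff f r * hCoeff f (s + 1) - gCoeff f s * hCoeff f (r + 1) := by
  rw [bez_of_le f (show r + 1 ≤ s from h), bez_of_le f (show r ≤ s + 1 by omega),
    Finset.sum_range_succ]
  have h1 : ∀ p ∈ Finset.range r,
      (((r + 1 : ℕ) : k) + s - 2 * p) * topCoeff f p * topCoeff f (r + 1 + s - p) =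
      ((r : k) + (s + 1 : ℕ) - 2 * p) * topCoeff f p * topCoeff f (r + (s + 1) - p) := by
    intro p _
    rw [show r + 1 + s - p = r + (s + 1) - p by omega]
    push_cast
    ring
  rw [Finset.sum_congr rfl h1, show r + 1 + s - r = s + 1 by omega]
  simp only [gCoeff, hCoeff]
  push_cast
  ring

lemma bez_succ_left (f : k[X]) (r s : ℕ) :
    bez f (r + 1) s =
      bez f r (s + 1) + gCoeff f r * hCoeff f (s + 1) - gCoeff f s * hCoeff f (r + 1) := by
  rcases lt_trichotomy r s with h | rfl | h
  · exact bez_succ_left_of_lt f h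
  · rw [bez_comm]
    ring
  · have := bez_succ_left_of_lt f h
    rw [bez_comm f (r + 1) s, bez_comm f r (s + 1), this]
    ring

lemma bez_of_natDegree_le (f : k[X]) (r : ℕ) {s : ℕ} (hs : f.natDegree ≤ s) :
    bez f r s = 0 := by
  induction r generalizing s with
  | zero => exact bez_zero_left f s
  | succ r ih =>
    have hH : hCoeff f (s + 1) = 0 := by
      rw [hCoeff, topCoeff_of_lt f (by omega), mul_zero]
    have hG : gCoeff f s = 0 := by
      rcases hs.eq_or_lt with rfl | h
      · simp [gCoeff]
      · rw [gCoeff, topCoeff_of_lt f h, mul_zero]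
    rw [bez_succ_left, ih (by omega), hH, hG]
    ring

/-! ### The rows of the Bezout matrix as polynomials -/

/-- The polynomial `h = n f - x f'`. -/
noncomputable def hPoly (f : k[X]) : k[X] :=
  C (f.natDegree : k) * f - X * derivative f

lemma coeff_hPoly (f : k[X]) {d s : ℕ} (h : d + s = f.natDegree) :
    (hPoly f).coeff d = hCoeff f s := by
  rw [hCoeff, topCoeff_eq_coeff f h, hPoly, coeff_sub, coeff_C_mul, ← h]
  cases d with
  | zero => simp
  | succ d =>
    rw [coeff_X_mul, coeff_derivative]
    push_cast
    ring

lemma coeff_hPoly_of_le (f : k[X]) {d : ℕ} (h : f.natDegree ≤ d) : (hPoly f).coeff d = 0 := by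
  rcases h.eq_or_lt with h | h
  · rw [coeff_hPoly f (s := 0) h.symm]
    simp [hCoeff]
  · rw [hPoly, coeff_sub, coeff_C_mul, coeff_eq_zero_of_natDegree_lt h]
    cases d with
    | zero => simp
    | succ d => rw [coeff_X_mul, coeff_derivative, coeff_eq_zero_of_natDegree_lt h]; simp

lemma coeff_derivative_eq_gCoeff (f : k[X]) {d s : ℕ} (h : d + s + 1 = f.natDegree) :
    (derivative f).coeff d = gCoeff f s := by
  rw [gCoeff, topCoeff_eq_coeff f (show (d + 1) + s = f.natDegree by omega), coeff_derivative, ← h]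
  push_cast
  ring

lemma coeff_derivative_of_le (f : k[X]) {d : ℕ} (h : f.natDegree ≤ d) :
    (derivative f).coeff d = 0 := by
  rw [coeff_derivative, coeff_eq_zero_of_natDegree_lt (by omega), zero_mul]

/-- The polynomial `A_r = G_0 x^{r-1} + … + G_{r-1}`, the factor of `h` in `B_r`. -/
noncomputable def hFactor (f : k[X]) : ℕ → k[X]
  | 0 => 0
  | r + 1 => X * hFactor f r + C (gCoeff f r)

/-- The polynomial `E_r = H_1 x^{r-1} + … + H_r`, the negative of the factor of `f'` in `B_r`. -/
noncomputable def gFactor (f : k[X]) : ℕ → k[X]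
  | 0 => 0
  | r + 1 => X * gFactor f r + C (hCoeff f (r + 1))

/-- The polynomial `B_r = A_r h - E_r f'`, whose coefficients form the `r`-th row of the Bezout
matrix. -/
noncomputable def bezRow (f : k[X]) (r : ℕ) : k[X] :=
  hFactor f r * hPoly f - gFactor f r * derivative f

lemma bezRow_succ (f : k[X]) (r : ℕ) :
    bezRow f (r + 1) = X * bezRow f r + C (gCoeff f r) * hPoly f
      - C (hCoeff f (r + 1)) * derivative f := by
  simp only [bezRow, hFactor, gFactor]
  ring

lemma coeff_bezRow (f : k[X]) (r : ℕ) {d s : ℕ} (h : d + s + 1 = f.natDegree) :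
    (bezRow f r).coeff d = bez f r s := by
  induction r generalizing d s with
  | zero => simp [bezRow, hFactor, gFactor, bez_zero_left]
  | succ r ih =>
    rw [bezRow_succ, coeff_sub, coeff_add, coeff_C_mul, coeff_C_mul,
      coeff_hPoly f (show d + (s + 1) = _ by omega), coeff_derivative_eq_gCoeff f h,
      bez_succ_left]
    cases d with
    | zero =>
      rw [coeff_X_mul_zero, bez_of_natDegree_le f r (by omega)]
      ring
    | succ d =>
      rw [coeff_X_mul, ih (show d + (s + 1) + 1 = _ by omega)]
      ring

lemma coeff_bezRow_of_le (f : k[X]) (r : ℕ) {d : ℕ} (h : f.natDegree ≤ d + 1) :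
    (bezRow f r).coeff d = 0 := by
  rcases h.eq_or_lt with h | h
  · rw [coeff_bezRow f r (s := 0) (by omega), bez_comm, bez_zero_left]
  induction r generalizing d with
  | zero => simp [bezRow, hFactor, gFactor]
  | succ r ih =>
    have hX : (X * bezRow f r).coeff d = 0 := by
      cases d with
      | zero => exact coeff_X_mul_zero _
      | succ d =>
        rw [coeff_X_mul]
        rcases Nat.lt_or_ge f.natDegree (d + 1) with h' | h'
        · exact ih (by omega) h'
        · rw [coeff_bezRow f r (s := 0) (by omega), bez_comm, bez_zero_left]
    rw [bezRow_succ, coeff_sub, coeff_add, coeff_C_mul, coeff_C_mul, hX,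
      coeff_hPoly_of_le f (by omega), coeff_derivative_of_le f (by omega)]
    ring

lemma degree_hFactor_lt (f : k[X]) (r : ℕ) : (hFactor f r).degree < r := by
  rw [degree_lt_iff_coeff_zero]
  induction r with
  | zero => simp [hFactor]
  | succ r ih =>
    intro d hd
    obtain ⟨d, rfl⟩ : ∃ e, d = e + 1 := ⟨d - 1, by omega⟩
    rw [hFactor, coeff_add, coeff_X_mul, coeff_C_succ, ih d (by omega), add_zero]

lemma coeff_hFactor_succ (f : k[X]) (r : ℕ) : (hFactor f (r + 1)).coeff r = gCoeff f 0 := by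
  induction r with
  | zero => simp [hFactor]
  | succ r ih => rw [hFactor, coeff_add, coeff_X_mul, coeff_C_succ, ih, add_zero]

/-- A polynomial `α h + β f'` with `deg α < m` and of degree `< n - 1` is a combination of
`B_1, …, B_m`; the coefficient of `B_m` is that of `x ^ (m-1)` in `α`, divided by `n a_n`. -/
lemma exists_eq_sum_bezRow (f : k[X]) (h0 : gCoeff f 0 ≠ 0)
    (hg : (derivative f).natDegree + 1 = f.natDegree) (m : ℕ) (α β : k[X]) (hα : α.degree < m)
    (hdeg : (α * hPoly f + β * derivative f).degree < (derivative f).degree) :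
    ∃ t : ℕ → k, α * hPoly f + β * derivative f =
        ∑ r ∈ Finset.range m, C (t r) * bezRow f (r + 1) ∧
      ∀ l, l + 1 = m → t l * gCoeff f 0 = α.coeff l := by
  induction m generalizing α β with
  | zero =>
    refine ⟨0, ?_, by simp⟩
    have hα0 : α = 0 := by
      rw [← degree_eq_bot]
      simpa using hα
    rw [hα0, zero_mul, zero_add] at hdeg ⊢
    -- a multiple of `f'` of smaller degree vanishes
    have : β = 0 := by
      by_contra hβ
      rw [degree_mul] at hdeg
      have h1 : (0 : WithBot ℕ) ≤ β.degree := zero_le_degree_iff.2 hβ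
      exact absurd hdeg (not_lt.2 (le_add_of_nonneg_left h1))
    simp [this]
  | succ m ih =>
    set τ := α.coeff m / gCoeff f 0 with hτ
    have hτ' : τ * gCoeff f 0 = α.coeff m := by rw [hτ]; field_simp
    have key : (α - C τ * hFactor f (m + 1)) * hPoly f +
        (β + C τ * gFactor f (m + 1)) * derivative f =
        (α * hPoly f + β * derivative f) - C τ * bezRow f (m + 1) := by
      rw [bezRow]
      ring
    have hB : (C τ * bezRow f (m + 1)).degree < (derivative f).degree := by
      have hne : derivative f ≠ 0 := by
        intro h
        rw [h] at hdeg
        simp at hdeg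
      rw [degree_eq_natDegree hne, degree_lt_iff_coeff_zero]
      intro d hd
      rw [coeff_C_mul, coeff_bezRow_of_le f _ (by omega), mul_zero]
    obtain ⟨t, ht, -⟩ := ih (α - C τ * hFactor f (m + 1)) (β + C τ * gFactor f (m + 1))
      (by
        rw [degree_lt_iff_coeff_zero]
        intro d hd
        rw [coeff_sub, coeff_C_mul]
        rcases hd.eq_or_lt with rfl | hd
        · rw [coeff_hFactor_succ, hτ', sub_self]
        · rw [(degree_lt_iff_coeff_zero _ _).1 hα d hd,
            (degree_lt_iff_coeff_zero _ _).1 (degree_hFactor_lt f (m + 1)) d hd]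
          simp)
      (by
        rw [key]
        exact (degree_sub_le _ _).trans_lt (max_lt hdeg hB))
    refine ⟨Function.update t m τ, ?_, ?_⟩
    · rw [Finset.sum_range_succ, Function.update_self]
      have : ∑ r ∈ Finset.range m, C (Function.update t m τ r) * bezRow f (r + 1) =
          ∑ r ∈ Finset.range m, C (t r) * bezRow f (r + 1) := by
        refine Finset.sum_congr rfl fun r hr => ?_
        rw [Function.update_of_ne (Finset.mem_range.1 hr).ne]
      rw [this, ← ht, key]
      ring
    · rintro l hl
      obtain rfl : l = m := by omega
      rw [Function.update_self, hτ']

/-! ### Degrees and cofactors in the Sturm sequence -/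

lemma sturm_ne_zero_of_succ {f : k[X]} {i : ℕ} (h : sturm f (i + 1) ≠ 0) : sturm f i ≠ 0 := by
  cases i with
  | zero =>
    rintro h0
    apply h
    rw [sturm] at h0
    rw [sturm, h0, derivative_zero]
  | succ i =>
    intro h0
    rw [sturm, if_pos h0] at h
    exact h rfl

lemma natDegree_sturm_succ_lt {f : k[X]} (hf : 0 < f.natDegree) {i : ℕ}
    (h : sturm f (i + 1) ≠ 0) : (sturm f (i + 1)).natDegree < (sturm f i).natDegree := by
  cases i with
  | zero =>
    rw [sturm, sturm]
    exact natDegree_derivative_lt hf.ne'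
  | succ i =>
    have h0 := sturm_ne_zero_of_succ h
    apply natDegree_lt_natDegree h
    rw [sturm, if_neg h0, degree_neg]
    exact EuclideanDomain.mod_lt _ h0

lemma natDegree_sturm_add_le {f : k[X]} (hf : 0 < f.natDegree) (i l : ℕ)
    (h : sturm f (i + l) ≠ 0) :
    sturm f i ≠ 0 ∧ (sturm f (i + l)).natDegree + l ≤ (sturm f i).natDegree := by
  induction l with
  | zero => exact ⟨h, le_rfl⟩
  | succ l ih =>
    have h1 := natDegree_sturm_succ_lt hf (i := i + l) h
    obtain ⟨h2, h3⟩ := ih (sturm_ne_zero_of_succ h)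
    refine ⟨h2, ?_⟩
    change (sturm f (i + l + 1)).natDegree + (l + 1) ≤ _
    omega

lemma sturm_normal {f : k[X]} (hf : 0 < f.natDegree) {j : ℕ} (hj : sturm f j ≠ 0)
    (hd : (sturm f j).natDegree + j = f.natDegree) {i : ℕ} (hi : i ≤ j) :
    sturm f i ≠ 0 ∧ (sturm f i).natDegree + i = f.natDegree := by
  obtain ⟨l, rfl⟩ := Nat.exists_eq_add_of_le hi
  obtain ⟨h1, h2⟩ := natDegree_sturm_add_le hf i l hj
  have h3 := (natDegree_sturm_add_le hf 0 i (by rwa [zero_add])).2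
  rw [zero_add] at h3
  change _ ≤ f.natDegree at h3
  exact ⟨h1, by omega⟩

lemma sturm_add_two {f : k[X]} {i : ℕ} (h : sturm f (i + 1) ≠ 0) :
    sturm f (i + 2) = sturm f i / sturm f (i + 1) * sturm f (i + 1) - sturm f i := by
  rw [sturm, if_neg h]
  have := EuclideanDomain.div_add_mod' (sturm f i) (sturm f (i + 1))
  linear_combination -this

/-- The factor `α_i` of `h` in the representation `f_i = α_i h + β_i f'`. -/
noncomputable def hCof (f : k[X]) : ℕ → k[X]
  | 0 => C ((f.natDegree : k)⁻¹)
  | 1 => 0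
  | i + 2 => sturm f i / sturm f (i + 1) * hCof f (i + 1) - hCof f i

/-- The factor `β_i` of `f'` in the representation `f_i = α_i h + β_i f'`. -/
noncomputable def gCof (f : k[X]) : ℕ → k[X]
  | 0 => C ((f.natDegree : k)⁻¹) * X
  | 1 => 1
  | i + 2 => sturm f i / sturm f (i + 1) * gCof f (i + 1) - gCof f i

lemma sturm_eq_cof [CharZero k] {f : k[X]} (hf : 0 < f.natDegree) (i : ℕ)
    (h : sturm f i ≠ 0) : sturm f i = hCof f i * hPoly f + gCof f i * derivative f := by
  induction i using Nat.twoStepInduction with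
  | zero =>
    have hn : (f.natDegree : k) ≠ 0 := by exact_mod_cast hf.ne'
    have hC : C ((f.natDegree : k)⁻¹) * C (f.natDegree : k) = 1 := by
      rw [← C_mul, inv_mul_cancel₀ hn, C_1]
    rw [sturm, hCof, gCof, hPoly]
    linear_combination (-f) * hC
  | one => simp [sturm, hCof, gCof]
  | more i ih0 ih1 =>
    have h1 := sturm_ne_zero_of_succ h
    have h0 := sturm_ne_zero_of_succ h1
    rw [sturm_add_two h1, hCof, gCof]
    linear_combination (sturm f i / sturm f (i + 1)) * ih1 h1 - ih0 h0

lemma div_of_natDegree_eq_succ {p q : k[X]} (hq : q ≠ 0) (h : p.natDegree = q.natDegree + 1) :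
    (p / q).natDegree = 1 ∧ (p / q).coeff 1 = p.leadingCoeff / q.leadingCoeff := by
  have hp : p ≠ 0 := by
    rintro rfl
    simp at h
  have hle : q.degree ≤ p.degree := by
    rw [degree_eq_natDegree hq, degree_eq_natDegree hp, h]
    exact_mod_cast Nat.le_succ _
  have h1 : (p / q).natDegree = 1 := by
    have h2 := degree_add_div hq hle
    have h3 : p / q ≠ 0 := by
      rintro h3
      rw [h3, degree_zero, WithBot.add_bot] at h2
      exact hp (degree_eq_bot.1 h2.symm)
    rw [degree_eq_natDegree hq, degree_eq_natDegree hp, degree_eq_natDegree h3, h] at h2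
    have h4 : q.natDegree + (p / q).natDegree = q.natDegree + 1 := by exact_mod_cast h2
    omega
  refine ⟨h1, ?_⟩
  rw [← leadingCoeff_div hle, leadingCoeff, h1]

/-- The cofactor `α_{i+2}` has degree at most `i`, and its coefficient at `x ^ i` is multiplied by
the quotient of the leading coefficients of `f_{i+1}` and `f_{i+2}` in each step. -/
lemma hCof_degree {f : k[X]} {j : ℕ}
    (hs : ∀ i ≤ j, sturm f i ≠ 0 ∧ (sturm f i).natDegree + i = f.natDegree) (i : ℕ)
    (hi : i + 2 ≤ j) : (hCof f (i + 1)).degree < i ∧ (hCof f (i + 2)).degree < (i + 1 : ℕ) := by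
  induction i with
  | zero =>
    refine ⟨by simp [hCof], ?_⟩
    simp only [hCof, mul_zero, zero_sub, degree_neg]
    exact degree_C_le.trans_lt (by simp)
  | succ i ih =>
    obtain ⟨h1, h2⟩ := ih (by omega)
    refine ⟨h2, ?_⟩
    have hq := (div_of_natDegree_eq_succ (hs (i + 2) (by omega)).1
      (p := sturm f (i + 1)) (by
        have := (hs (i + 1) (by omega)).2
        have := (hs (i + 2) (by omega)).2
        omega)).1
    rw [degree_lt_iff_coeff_zero] at h1 h2 ⊢
    intro d hd
    obtain ⟨d, rfl⟩ : ∃ e, d = e + 1 := ⟨d - 1, by omega⟩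
    rw [hCof, coeff_sub, h1 _ (by omega), sub_zero,
      eq_X_add_C_of_natDegree_le_one hq.le, add_mul, coeff_add, mul_assoc, coeff_C_mul,
      coeff_C_mul, coeff_X_mul, h2 _ (by omega), h2 _ (by omega)]
    simp

lemma coeff_hCof_add_three {f : k[X]} {j : ℕ}
    (hs : ∀ i ≤ j, sturm f i ≠ 0 ∧ (sturm f i).natDegree + i = f.natDegree) (i : ℕ)
    (hi : i + 3 ≤ j) : (hCof f (i + 3)).coeff (i + 1) =
      (sturm f (i + 1)).leadingCoeff / (sturm f (i + 2)).leadingCoeff *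
        (hCof f (i + 2)).coeff i := by
  obtain ⟨h1, h2⟩ := hCof_degree hs i (by omega)
  obtain ⟨hq, hq1⟩ := div_of_natDegree_eq_succ (hs (i + 2) (by omega)).1
    (p := sturm f (i + 1)) (by
      have := (hs (i + 1) (by omega)).2
      have := (hs (i + 2) (by omega)).2
      omega)
  rw [degree_lt_iff_coeff_zero] at h1 h2
  rw [hCof, coeff_sub, h1 _ (by omega), sub_zero, ← hq1]
  conv_lhs => rw [eq_X_add_C_of_natDegree_le_one hq.le]
  rw [add_mul, coeff_add, mul_assoc, coeff_C_mul, coeff_C_mul, coeff_X_mul, h2 (i + 1) le_rfl,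
    mul_zero, add_zero]

/-! ### Triangularization and determinants -/

/-- The coefficient of `B_{i+1}` in the expansion of `f_{i+2}` by `B_1, …, B_{i+1}`. -/
noncomputable def topMult (f : k[X]) (i : ℕ) : k :=
  (hCof f (i + 2)).coeff i / gCoeff f 0

lemma gCoeff_zero (f : k[X]) : gCoeff f 0 = f.natDegree * f.leadingCoeff := by
  rw [gCoeff, topCoeff_eq_coeff f (d := f.natDegree) rfl, Nat.cast_zero, sub_zero, leadingCoeff]

lemma gCoeff_zero_ne_zero [CharZero k] {f : k[X]} (hf : 0 < f.natDegree) : gCoeff f 0 ≠ 0 := by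
  rw [gCoeff_zero]
  refine mul_ne_zero (by exact_mod_cast hf.ne') ?_
  rw [leadingCoeff_ne_zero]
  rintro rfl
  simp at hf

lemma exists_sturm_eq_sum_bezRow [CharZero k] {f : k[X]} (hf : 0 < f.natDegree) {j : ℕ}
    (hs : ∀ i ≤ j, sturm f i ≠ 0 ∧ (sturm f i).natDegree + i = f.natDegree) (i : ℕ)
    (hi : i + 2 ≤ j) :
    ∃ t : ℕ → k, sturm f (i + 2) = ∑ r ∈ Finset.range (i + 1), C (t r) * bezRow f (r + 1) ∧
      t i = topMult f i := by
  have h0 := gCoeff_zero_ne_zero hf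
  have hg := hs 1 (by omega)
  rw [sturm] at hg
  have hi2 := hs (i + 2) hi
  have heq := sturm_eq_cof hf (i + 2) hi2.1
  obtain ⟨t, ht, ht'⟩ := exists_eq_sum_bezRow f h0 hg.2 (i + 1) (hCof f (i + 2)) (gCof f (i + 2))
    (hCof_degree hs i hi).2
    (by
      rw [← heq]
      exact degree_lt_degree (by omega))
  refine ⟨t, heq.trans ht, ?_⟩
  rw [topMult, ← ht' i rfl, mul_div_cancel_right₀ _ h0]

/-- The number of the row of the Bezout matrix that is placed in row `s + 1` of `C(M+2)_p`. -/
def shiftIdx (M p s : ℕ) : ℕ := if s = M then M + 1 + p else s + 1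

lemma matCShift_apply (f : k[X]) (M p : ℕ) (s r : Fin (M + 1)) :
    matCShift f (M + 2) p s r = bez f (r + 1) (shiftIdx M p s) := by
  have hr := r.2
  by_cases h : (s : ℕ) = M
  · simp only [matCShift, Matrix.of_apply]
    rw [if_pos (by omega), shiftIdx, if_pos h, bez]
    congr 1 <;> omega
  · simp only [matCShift, Matrix.of_apply, matC]
    rw [if_neg (by omega), shiftIdx, if_neg h, bez_comm, bez]

/-- Comparison of the determinants of a lower triangular matrix, of `C(M+2)_p` and of their upper
triangular product. -/
lemma prod_mul_c [CharZero k] {f : k[X]} (hf : 0 < f.natDegree) {j : ℕ}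
    (hs : ∀ i ≤ j, sturm f i ≠ 0 ∧ (sturm f i).natDegree + i = f.natDegree) (M : ℕ)
    (hM : M + 2 ≤ j) (p d : ℕ) (hd : d + p + (M + 2) = f.natDegree) :
    (∏ i ∈ Finset.range (M + 1), topMult f i) * c f (M + 2) p =
      (∏ i ∈ Finset.range M, (sturm f (i + 2)).leadingCoeff) * (sturm f (M + 2)).coeff d := by
  have hex : ∀ i : Fin (M + 1), ∃ t : ℕ → k, sturm f (i + 2) =
      ∑ r ∈ Finset.range (i + 1), C (t r) * bezRow f (r + 1) ∧ t i = topMult f i := fun i =>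
    exists_sturm_eq_sum_bezRow hf hs i (by have := i.2; omega)
  choose t ht htop using hex
  let T : Matrix (Fin (M + 1)) (Fin (M + 1)) k :=
    Matrix.of fun i r => if (r : ℕ) < i + 1 then t i r else 0
  let S : Matrix (Fin (M + 1)) (Fin (M + 1)) k := matCShift f (M + 2) p
  have hTS : ∀ (i s : Fin (M + 1)) (e : ℕ), e + shiftIdx M p s + 1 = f.natDegree →
      (T * S.transpose) i s = (sturm f (i + 2)).coeff e := by
    intro i s e he
    have hsub : Finset.range (i + 1) ⊆ Finset.range (M + 1) := by
      have := i.2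
      exact Finset.range_subset_range.2 (by omega)
    rw [ht i, finsetSum_coeff, Matrix.mul_apply]
    have : ∀ r : Fin (M + 1), T i r * S.transpose r s =
        (fun r : ℕ => if r ∈ Finset.range ((i : ℕ) + 1) then
          (C (t i r) * bezRow f (r + 1)).coeff e else 0) r := by
      intro r
      simp only [T, S, Matrix.transpose_apply, Matrix.of_apply, matCShift_apply, Finset.mem_range,
        coeff_C_mul, coeff_bezRow f _ he, ite_mul, zero_mul]
    rw [Finset.sum_congr rfl fun r _ => this r, Fin.sum_univ_eq_sum_range (fun r : ℕ =>
      if r ∈ Finset.range ((i : ℕ) + 1) then (C (t i r) * bezRow f (r + 1)).coeff e else 0) (M + 1),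
      Finset.sum_ite_mem, Finset.inter_eq_right.2 hsub]
  have hTdet : T.det = ∏ i ∈ Finset.range (M + 1), topMult f i := by
    rw [Matrix.det_of_isLowerTriangular T, ← Fin.prod_univ_eq_prod_range]
    · refine Finset.prod_congr rfl fun i _ => ?_
      simp only [T, Matrix.of_apply]
      rw [if_pos (by omega), htop]
    · intro i r hir
      have hir' : (i : ℕ) < r := hir
      simp only [T, Matrix.of_apply]
      rw [if_neg (by omega)]
  have hidx : ∀ s : Fin (M + 1), (s : ℕ) ≠ M → shiftIdx M p s = s + 1 := fun s h => if_neg h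
  have hprod : (T * S.transpose).det =
      (∏ i ∈ Finset.range M, (sturm f (i + 2)).leadingCoeff) * (sturm f (M + 2)).coeff d := by
    rw [Matrix.det_of_isUpperTriangular, Fin.prod_univ_castSucc, ← Fin.prod_univ_eq_prod_range]
    · congr 1
      · refine Finset.prod_congr rfl fun i _ => ?_
        have hi := i.2
        have hdeg := (hs (i + 2) (by omega)).2
        rw [hTS i.castSucc i.castSucc (sturm f (i + 2)).natDegree, leadingCoeff, Fin.val_castSucc]
        rw [hidx _ (by rw [Fin.val_castSucc]; omega), Fin.val_castSucc]
        omega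
      · rw [hTS (Fin.last M) (Fin.last M) d, Fin.val_last]
        rw [shiftIdx, if_pos (Fin.val_last M)]
        omega
    · intro i s hsi
      have hsi' : (s : ℕ) < i := hsi
      have hi := i.2
      have hdeg := (hs (i + 2) (by omega)).2
      rw [hTS i s (f.natDegree - (s + 2))]
      · exact coeff_eq_zero_of_natDegree_lt (by omega)
      · rw [hidx _ (by omega)]
        omega
  rw [← hTdet, ← hprod, Matrix.det_mul, Matrix.det_transpose, c, if_neg (by omega)]

lemma c_one [CharZero k] {f : k[X]} (hf : 0 < f.natDegree) : c f 1 0 = 1 := by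
  have h := gCoeff_zero_ne_zero hf
  simp only [gCoeff, topCoeff, Nat.cast_zero, sub_zero] at h
  rw [c, if_pos rfl]
  simp only [Nat.cast_zero, sub_zero]
  exact div_self h

/-! ### The scaling factors -/

lemma topMult_zero (f : k[X]) :
    topMult f 0 = -1 / ((f.natDegree : k) ^ 2 * f.leadingCoeff) := by
  rw [topMult, gCoeff_zero]
  simp only [hCof, mul_zero, zero_sub, coeff_neg, coeff_C_zero]
  rw [neg_div, neg_div, inv_eq_one_div, div_div]
  congr 2
  ring

lemma topMult_ne_zero [CharZero k] {f : k[X]} (hf : 0 < f.natDegree) {j : ℕ}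
    (hs : ∀ i ≤ j, sturm f i ≠ 0 ∧ (sturm f i).natDegree + i = f.natDegree) (i : ℕ)
    (hi : i + 2 ≤ j) : topMult f i ≠ 0 := by
  refine div_ne_zero ?_ (gCoeff_zero_ne_zero hf)
  induction i with
  | zero =>
    simp only [hCof, mul_zero, zero_sub, coeff_neg, coeff_C_zero]
    exact neg_ne_zero.2 (inv_ne_zero (by exact_mod_cast hf.ne'))
  | succ i ih =>
    rw [coeff_hCof_add_three hs i (by omega)]
    exact mul_ne_zero (div_ne_zero (leadingCoeff_ne_zero.2 (hs _ (by omega)).1)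
      (leadingCoeff_ne_zero.2 (hs _ (by omega)).1)) (ih (by omega))

lemma topMult_succ {f : k[X]} {j : ℕ}
    (hs : ∀ i ≤ j, sturm f i ≠ 0 ∧ (sturm f i).natDegree + i = f.natDegree) (i : ℕ)
    (hi : i + 3 ≤ j) : topMult f (i + 1) =
      (sturm f (i + 1)).leadingCoeff / (sturm f (i + 2)).leadingCoeff * topMult f i := by
  rw [topMult, coeff_hCof_add_three hs i hi, topMult, mul_div_assoc]

lemma prod_mul_c_zero [CharZero k] {f : k[X]} (hf : 0 < f.natDegree) {j : ℕ}
    (hs : ∀ i ≤ j, sturm f i ≠ 0 ∧ (sturm f i).natDegree + i = f.natDegree) (m : ℕ)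
    (hm : m + 1 ≤ j) : (∏ i ∈ Finset.range m, topMult f i) * c f (m + 1) 0 =
      ∏ i ∈ Finset.range m, (sturm f (i + 2)).leadingCoeff := by
  cases m with
  | zero => simp [c_one hf]
  | succ M =>
    rw [prod_mul_c hf hs M hm 0 (sturm f (M + 2)).natDegree (hs _ hm).2, Finset.prod_range_succ,
      leadingCoeff]

lemma c_zero_ne_zero [CharZero k] {f : k[X]} (hf : 0 < f.natDegree) {j : ℕ}
    (hs : ∀ i ≤ j, sturm f i ≠ 0 ∧ (sturm f i).natDegree + i = f.natDegree) (m : ℕ)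
    (hm : m + 1 ≤ j) : c f (m + 1) 0 ≠ 0 := by
  intro h
  have := prod_mul_c_zero hf hs m hm
  rw [h, mul_zero] at this
  refine Finset.prod_ne_zero_iff.2 (fun i hi => ?_) this.symm
  rw [Finset.mem_range] at hi
  exact leadingCoeff_ne_zero.2 (hs _ (by omega)).1

lemma topMult_mul_c [CharZero k] {f : k[X]} (hf : 0 < f.natDegree) {j : ℕ}
    (hs : ∀ i ≤ j, sturm f i ≠ 0 ∧ (sturm f i).natDegree + i = f.natDegree) (m : ℕ)
    (hm : m + 2 ≤ j) :
    topMult f m * c f (m + 2) 0 = c f (m + 1) 0 * (sturm f (m + 2)).leadingCoeff := by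
  have h1 := prod_mul_c_zero hf hs m (by omega)
  have h2 := prod_mul_c_zero hf hs (m + 1) hm
  have h3 : ∏ i ∈ Finset.range m, topMult f i ≠ 0 := by
    refine Finset.prod_ne_zero_iff.2 fun i hi => ?_
    rw [Finset.mem_range] at hi
    exact topMult_ne_zero hf hs i (by omega)
  rw [Finset.prod_range_succ, Finset.prod_range_succ, ← h1] at h2
  apply mul_left_cancel₀ h3
  linear_combination h2

lemma gam_mul_c_zero [CharZero k] {f : k[X]} (hf : 0 < f.natDegree) {j : ℕ}
    (hs : ∀ i ≤ j, sturm f i ≠ 0 ∧ (sturm f i).natDegree + i = f.natDegree) (m : ℕ)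
    (hm : m + 1 ≤ j) : gam f (m + 1) * c f (m + 1) 0 = (sturm f (m + 1)).leadingCoeff := by
  induction m using Nat.twoStepInduction with
  | zero =>
    have hd := (hs 1 hm).2
    rw [zero_add, c_one hf, mul_one, leadingCoeff]
    rw [sturm] at hd ⊢
    rw [coeff_derivative_eq_gCoeff f (s := 0) hd]
    simp [gam, gCoeff, topCoeff]
  | one =>
    have h := topMult_mul_c hf hs 0 hm
    have hlc : coeffZ f (f.natDegree : ℤ) = f.leadingCoeff := by
      rw [coeffZ, if_neg (by omega), Int.toNat_natCast, leadingCoeff]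
    rw [topMult_zero, zero_add, zero_add, c_one hf, one_mul] at h
    rw [← h, gam, hlc]
  | more m ih _ =>
    have h1 := topMult_mul_c hf hs m (by omega)
    have h2 := topMult_mul_c hf hs (m + 1) hm
    have hτ := topMult_succ hs m hm
    have hτ0 := topMult_ne_zero hf hs m (by omega)
    have hτ1 := topMult_ne_zero hf hs (m + 1) hm
    have hc0 := c_zero_ne_zero hf hs m (by omega)
    have hc1 := c_zero_ne_zero hf hs (m + 1) (by omega)
    have hl := leadingCoeff_ne_zero.2 (hs (m + 2) (by omega)).1
    have hl1 := leadingCoeff_ne_zero.2 (hs (m + 1) (by omega)).1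
    have e1 : topMult f (m + 1) =
        (sturm f (m + 1)).leadingCoeff * c f (m + 1) 0 / c f (m + 2) 0 := by
      rw [hτ, eq_div_iff hc1, div_mul_eq_mul_div, div_mul_eq_mul_div, div_eq_iff hl]
      linear_combination (sturm f (m + 1)).leadingCoeff * h1
    have e2 : c f (m + 3) 0 =
        c f (m + 2) 0 * (sturm f (m + 3)).leadingCoeff / topMult f (m + 1) := by
      rw [eq_div_iff hτ1, mul_comm]
      exact h2
    have e3 := ih (by omega)
    change gam f (m + 3) * c f (m + 3) 0 = (sturm f (m + 3)).leadingCoeff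
    rw [gam, e2, e1]
    field_simp
    linear_combination (sturm f (m + 3)).leadingCoeff * e3

lemma gam_mul_c [CharZero k] {f : k[X]} (hf : 0 < f.natDegree) {j : ℕ}
    (hs : ∀ i ≤ j, sturm f i ≠ 0 ∧ (sturm f i).natDegree + i = f.natDegree) (m : ℕ)
    (hm : m + 1 ≤ j) (p d : ℕ) (hd : d + p + (m + 1) = f.natDegree) :
    gam f (m + 1) * c f (m + 1) p = (sturm f (m + 1)).coeff d := by
  cases m with
  | zero =>
    have h := gCoeff_zero_ne_zero hf
    simp only [gCoeff, topCoeff, Nat.cast_zero, sub_zero] at h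
    rw [zero_add, gam, c, if_pos rfl, mul_div_cancel₀ _ h, sturm,
      coeff_derivative_eq_gCoeff f (s := p) hd, gCoeff, topCoeff]
  | succ M =>
    have h1 := prod_mul_c hf hs M hm p d hd
    have h2 := prod_mul_c hf hs M hm 0 (sturm f (M + 2)).natDegree (hs _ hm).2
    have h3 := gam_mul_c_zero hf hs (M + 1) hm
    have hl := leadingCoeff_ne_zero.2 (hs (M + 2) hm).1
    have hT : ∏ i ∈ Finset.range (M + 1), topMult f i ≠ 0 := by
      refine Finset.prod_ne_zero_iff.2 fun i hi => ?_
      rw [Finset.mem_range] at hi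
      exact topMult_ne_zero hf hs i (by omega)
    rw [coeff_natDegree] at h2
    have h4 : c f (M + 2) p * (sturm f (M + 2)).leadingCoeff =
        c f (M + 2) 0 * (sturm f (M + 2)).coeff d := by
      apply mul_left_cancel₀ hT
      linear_combination (sturm f (M + 2)).leadingCoeff * h1 - (sturm f (M + 2)).coeff d * h2
    apply mul_right_cancel₀ hl
    linear_combination gam f (M + 2) * h4 + (sturm f (M + 2)).coeff d * h3

end SturmQuadrics

theorem mainTheorem1 {k : Type*} [Field k] [CharZero k] (f : Polynomial k)
    (n : ℕ) (hn : 0 < n) (hf : f.natDegree = n)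
    (j : ℕ) (hjn : j ≤ n)
    (hj : (SturmQuadrics.sturm f j).degree = ((n - j : ℕ) : WithBot ℕ)) :
    (∀ i : ℕ, i ≤ j → (SturmQuadrics.sturm f i).degree = ((n - i : ℕ) : WithBot ℕ)) ∧
    ∀ i : ℕ, 1 ≤ i → i ≤ j →
      SturmQuadrics.c f i 0 ≠ 0 ∧
      SturmQuadrics.sturm f i =
        Polynomial.C (SturmQuadrics.gam f i) *
          ∑ p ∈ Finset.range (n - i + 1),
            Polynomial.C (SturmQuadrics.c f i p) * Polynomial.X ^ (n - i - p) ∧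
      (SturmQuadrics.sturm f i).leadingCoeff =
        SturmQuadrics.gam f i * SturmQuadrics.c f i 0 := by
  subst hf
  have hj0 : SturmQuadrics.sturm f j ≠ 0 := by
    intro h
    rw [h, degree_zero] at hj
    exact WithBot.bot_ne_coe hj
  have hjd := natDegree_eq_of_degree_eq_some hj
  have hs : ∀ i ≤ j, SturmQuadrics.sturm f i ≠ 0 ∧
      (SturmQuadrics.sturm f i).natDegree + i = f.natDegree := fun i hi =>
    SturmQuadrics.sturm_normal hn hj0 (by omega) hi
  refine ⟨fun i hi => ?_, fun i hi1 hi => ?_⟩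
  · obtain ⟨h1, h2⟩ := hs i hi
    rw [degree_eq_natDegree h1, ← h2, Nat.add_sub_cancel]
  · obtain ⟨m, rfl⟩ : ∃ m, i = m + 1 := ⟨i - 1, by omega⟩
    have hd := (hs _ hi).2
    refine ⟨SturmQuadrics.c_zero_ne_zero hn hs m hi, ?_,
      (SturmQuadrics.gam_mul_c_zero hn hs m hi).symm⟩
    have hN : f.natDegree - (m + 1) = (SturmQuadrics.sturm f (m + 1)).natDegree := by omega
    rw [hN]
    conv_lhs => rw [as_sum_range_C_mul_X_pow (SturmQuadrics.sturm f (m + 1)),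
      ← Finset.sum_range_reflect]
    rw [Finset.mul_sum]
    refine Finset.sum_congr rfl fun p hp => ?_
    rw [Finset.mem_range] at hp
    have he : (SturmQuadrics.sturm f (m + 1)).natDegree + 1 - 1 - p =
        (SturmQuadrics.sturm f (m + 1)).natDegree - p := by omega
    rw [he, ← mul_assoc, ← C_mul, SturmQuadrics.gam_mul_c hn hs m hi p
      ((SturmQuadrics.sturm f (m + 1)).natDegree - p) (by omega)]
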